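/- Let $0<a<b<\infty$, $0<c<d<\infty$, let $p,q>-1$ and $\alpha,\beta>0$ be real numbers, and let $f:[a,b]\times[c,d]\to\mathbb{R}$ be continuous and of bounded variation in the sense of Arzelà, that is, the sums $$\sum_{i=0}^{m-1}\bigl|f(x_{i+1},y_{i+1})-f(x_i,y_i)\bigr|$$ are bounded by a constant independent of $m$ and of the points $a=x_0\le x_1\le\dots\le x_m=b$ and $c=y_0\le y_1\le\dots\le y_m=d$. For $(x,y)\in[a,b]\times[c,d]$ let $$F(x,y)=\frac{(p+1)^{1-\alpha}(q+1)^{1-\beta}}{\Gamma(\alpha)\Gamma(\beta)}\int_a^x\int_c^y (x^{p+1}-s^{p+1})^{\alpha-1}(y^{q+1}-t^{q+1})^{\beta-1}s^p t^q f(s,t)\,dt\,ds$$ be the mixed Katugampola fractional integral of $f$. Then the graph $$G(F)=\{(x,y,F(x,y)):(x,y)\in[a,b]\times[c,d]\}\subset\mathbb{R}^3$$ satisfies $\dim_B G(F)=\dim_H G(F)=2$. Here $\dim_H$ is the Hausdorff dimension, and the box dimension of a nonempty bounded set $A\subset\mathbb{R}^3$ is $\dim_B A=\lim_{\delta\to0^+}\frac{\log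 N_\delta(A)}{-\log\delta}$, with $N_\delta(A)$ the smallest number of sets of diameter at most $\delta$ that cover $A$; the assertion includes that this limit exists. -/

import Mathlib

open Set Filter Topology MeasureTheory

/-- Functions on the rectangle `[a,b] × [c,d]` are represented by functions on `ℝ × ℝ`, of which
only the values on the rectangle matter. `f` is of bounded variation in the sense of Arzelà on
`[a,b] × [c,d]` if the sums `∑_{i<m} |f (x_{i+1}, y_{i+1}) - f (x_i, y_i)|` over all finite
nondecreasing chains from `(a,c)` to `(b,d)` are bounded by a common constant. -/
def ArzelaBV (a b c d : ℝ) (f : ℝ × ℝ → ℝ) : Prop :=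
  ∃ M : ℝ, ∀ (m : ℕ) (x y : ℕ → ℝ),
    x 0 = a → x m = b → (∀ i < m, x i ≤ x (i + 1)) →
    y 0 = c → y m = d → (∀ i < m, y i ≤ y (i + 1)) →
    ∑ i ∈ Finset.range m, |f (x (i + 1), y (i + 1)) - f (x i, y i)| ≤ M

/-- The mixed (left-hand sided) Katugampola fractional integral of `f` with parameters `p, q`,
orders `α, β` and base point `(a, c)`, evaluated at `(x, y)`. -/
noncomputable def mixedKatugampola (p q a c α β : ℝ) (f : ℝ × ℝ → ℝ) (x y : ℝ) : ℝ :=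
  (p + 1) ^ (1 - α) * (q + 1) ^ (1 - β) / (Real.Gamma α * Real.Gamma β) *
    ∫ s in a..x, ∫ t in c..y,
      (x ^ (p + 1) - s ^ (p + 1)) ^ (α - 1) * (y ^ (q + 1) - t ^ (q + 1)) ^ (β - 1) *
        s ^ p * t ^ q * f (s, t)

/-- The graph of `F` over the rectangle `[a,b] × [c,d]`, in Euclidean 3-space. -/
def graphOnRect (a b c d : ℝ) (F : ℝ → ℝ → ℝ) : Set (EuclideanSpace ℝ (Fin 3)) :=
  {z | ∃ x ∈ Icc a b, ∃ y ∈ Icc c d, z = !₂[x, y, F x y]}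

/-- The smallest number of sets of diameter at most `δ` that cover `A` (for `A` bounded in
Euclidean space and `δ > 0` such finite covers exist). -/
noncomputable def minCoverCard {X : Type*} [PseudoMetricSpace X] (δ : ℝ) (A : Set X) : ℕ :=
  sInf {n : ℕ | ∃ U : Fin n → Set X,
    (∀ i, Metric.ediam (U i) ≤ ENNReal.ofReal δ) ∧ A ⊆ ⋃ i, U i}

/-- The nonempty bounded set `A` has box (box-counting) dimension `D`: the limit of
`log N_δ(A) / (-log δ)` as `δ → 0+` exists and equals `D`, i.e. the lower and upper box dimensions
of `A` both equal `D`. -/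
def HasBoxDim {n : ℕ} (A : Set (EuclideanSpace ℝ (Fin n))) (D : ℝ) : Prop :=
  A.Nonempty ∧ Bornology.IsBounded A ∧
    Tendsto (fun δ : ℝ => Real.log (minCoverCard δ A) / (-Real.log δ)) (𝓝[>] 0) (𝓝 D)

/-! Write F for the fractional integral. The substitutions s^(p+1) = (1-θ)a^(p+1) + θx^(p+1) and its
analogue in t turn F into a product of powers of x^(p+1) - a^(p+1) and y^(q+1) - c^(q+1) with an
average of f over points φ(x, y; θ, η), against a finite measure in (θ, η) that does not depend on
(x, y) (`mixedKatugampola_eq`). For fixed (θ, η) the map φ is monotone in (x, y), so it carries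
chains to chains, and the average inherits bounded variation from f (`ChainBV.integral`). The power
factor is monotone and bounded, so F is of bounded variation along chains.

Such an F has a bounded monotone variation function g, whose increments between comparable points
dominate those of F. Cut the rectangle into n × n cells with n of order 1/δ. On a cell F deviates
from its value at the lower corner by at most the increment of g across the cell. Along each of the
fewer than 2n diagonals these increments telescope, so their total is O(n) (`sum_diagonal_sub_le`).
Hence O(n² + n/δ) = O(δ⁻²) sets of diameter δ cover the graph, which bounds both dimensions above by
2.

The lower bounds hold for any graph over the rectangle: its projection to the plane is 1-Lipschitz
with image of positive area and nonempty interior. -/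

/-! ### Bounded variation along chains -/

/-- The sums of `|f (P (i+1)) - f (P i)|` along monotone sequences in `S` are bounded by `M`. -/
def ChainBV (S : Set (ℝ × ℝ)) (f : ℝ × ℝ → ℝ) (M : ℝ) : Prop :=
  ∀ P : ℕ → ℝ × ℝ, Monotone P → (∀ i, P i ∈ S) →
    ∀ m : ℕ, ∑ i ∈ Finset.range m, |f (P (i + 1)) - f (P i)| ≤ M

/-- A chain that need not touch the corners is prolonged to one from (a, c) to (b, d); the two extra
summands are nonnegative. -/
lemma ArzelaBV.exists_chainBV {a b c d : ℝ} {f : ℝ × ℝ → ℝ}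
    (h : ArzelaBV a b c d f) : ∃ M, ChainBV (Icc (a, c) (b, d)) f M := by
  obtain ⟨M, hM⟩ := h
  refine ⟨M, fun P hP hS m => ?_⟩
  have hS' : ∀ i, a ≤ (P i).1 ∧ c ≤ (P i).2 ∧ (P i).1 ≤ b ∧ (P i).2 ≤ d := fun i =>
    ⟨(hS i).1.1, (hS i).1.2, (hS i).2.1, (hS i).2.2⟩
  -- Index 0 is the lower corner, indices 1 to m + 1 are P 0 to P m, and all later ones are the
  -- upper corner.
  let x : ℕ → ℝ := fun i => if i = 0 then a else if i ≤ m + 1 then (P (i - 1)).1 else b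
  let y : ℕ → ℝ := fun i => if i = 0 then c else if i ≤ m + 1 then (P (i - 1)).2 else d
  have key := hM (m + 2) x y (by simp [x]) (by simp [x])
    (fun i _ => by
      rcases i with _ | i
      · simpa [x] using (hS' 0).1
      · by_cases h1 : i + 1 ≤ m
        · have h2 : i ≤ m := by omega
          simpa [x, h1, h2] using (hP (Nat.le_succ i)).1
        · by_cases h2 : i ≤ m
          · simpa [x, h1, h2] using (hS' i).2.2.1
          · simp [x, h1, h2])
    (by simp [y]) (by simp [y])
    (fun i _ => by
      rcases i with _ | i
      · simpa [y] using (hS' 0).2.1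
      · by_cases h1 : i + 1 ≤ m
        · have h2 : i ≤ m := by omega
          simpa [y, h1, h2] using (hP (Nat.le_succ i)).2
        · by_cases h2 : i ≤ m
          · simpa [y, h1, h2] using (hS' i).2.2.2
          · simp [y, h1, h2])
  rw [Finset.sum_range_succ, Finset.sum_range_succ'] at key
  have hmid : ∑ i ∈ Finset.range m, |f (x (i + 1 + 1), y (i + 1 + 1)) - f (x (i + 1), y (i + 1))|
      = ∑ i ∈ Finset.range m, |f (P (i + 1)) - f (P i)| := by
    refine Finset.sum_congr rfl fun i hi => ?_
    have h1 : i + 1 ≤ m := Finset.mem_range.1 hi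
    have h2 : i ≤ m := by omega
    simp [x, y, h1, h2]
  rw [hmid] at key
  have := abs_nonneg (f (x (0 + 1), y (0 + 1)) - f (x 0, y 0))
  have := abs_nonneg (f (x (m + 1 + 1), y (m + 1 + 1)) - f (x (m + 1), y (m + 1)))
  linarith

/-- A product of bounded functions of bounded variation along chains is such a function. -/
lemma ChainBV.mul {S : Set (ℝ × ℝ)} {f g : ℝ × ℝ → ℝ} {M N B C : ℝ} (hf : ChainBV S f M)
    (hg : ChainBV S g N) (hB : ∀ p ∈ S, |f p| ≤ B) (hC : ∀ p ∈ S, |g p| ≤ C) :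
    ChainBV S (fun p => f p * g p) (B * N + C * M) := by
  intro P hP hS m
  have hB0 : 0 ≤ B := (abs_nonneg _).trans (hB _ (hS 0))
  have hC0 : 0 ≤ C := (abs_nonneg _).trans (hC _ (hS 0))
  calc ∑ i ∈ Finset.range m, |f (P (i + 1)) * g (P (i + 1)) - f (P i) * g (P i)|
      ≤ ∑ i ∈ Finset.range m,
          (B * |g (P (i + 1)) - g (P i)| + C * |f (P (i + 1)) - f (P i)|) := by
        refine Finset.sum_le_sum fun i _ => ?_
        have : f (P (i + 1)) * g (P (i + 1)) - f (P i) * g (P i)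
            = f (P (i + 1)) * (g (P (i + 1)) - g (P i))
              + g (P i) * (f (P (i + 1)) - f (P i)) := by ring
        rw [this]
        refine (abs_add_le _ _).trans ?_
        rw [abs_mul, abs_mul]
        gcongr
        · exact hB _ (hS _)
        · exact hC _ (hS _)
    _ = B * ∑ i ∈ Finset.range m, |g (P (i + 1)) - g (P i)|
          + C * ∑ i ∈ Finset.range m, |f (P (i + 1)) - f (P i)| := by
        rw [Finset.sum_add_distrib, Finset.mul_sum, Finset.mul_sum]
    _ ≤ _ := by
        gcongr
        · exact hg P hP hS m
        · exact hf P hP hS m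

/-- A nondecreasing bounded function is of bounded variation along chains. -/
lemma MonotoneOn.chainBV {S : Set (ℝ × ℝ)} {f : ℝ × ℝ → ℝ} {B : ℝ} (hf : MonotoneOn f S)
    (hB : ∀ p ∈ S, |f p| ≤ B) : ChainBV S f (2 * B) := by
  intro P hP hS m
  have : ∀ i, |f (P (i + 1)) - f (P i)| = f (P (i + 1)) - f (P i) := fun i =>
    abs_of_nonneg (sub_nonneg.2 (hf (hS _) (hS _) (hP (Nat.le_succ i))))
  simp_rw [this]
  rw [Finset.sum_range_sub (fun i => f (P i))]
  have h1 := (abs_le.1 (hB _ (hS m))).2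
  have h2 := (abs_le.1 (hB _ (hS 0))).1
  linarith

/-- A function of bounded variation along chains has a monotone variation function. -/
lemma ChainBV.exists_majorant {S : Set (ℝ × ℝ)} {f : ℝ × ℝ → ℝ} {M : ℝ} (h : ChainBV S f M) :
    ∃ g : ℝ × ℝ → ℝ, (∀ p ∈ S, 0 ≤ g p ∧ g p ≤ M) ∧
      ∀ p ∈ S, ∀ q ∈ S, p ≤ q → |f q - f p| ≤ g q - g p := by
  -- The variation function at p is the supremum over chains in S that stay below p.
  let V : ℝ × ℝ → Set ℝ := fun p =>
    {v | ∃ (P : ℕ → ℝ × ℝ) (m : ℕ), Monotone P ∧ (∀ i, P i ∈ S) ∧ (∀ i, P i ≤ p) ∧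
      v = ∑ i ∈ Finset.range m, |f (P (i + 1)) - f (P i)|}
  have hbdd : ∀ p, BddAbove (V p) := fun p => ⟨M, by
    rintro v ⟨P, m, hP, hS, -, rfl⟩
    exact h P hP hS m⟩
  have h0 : ∀ p ∈ S, (0 : ℝ) ∈ V p := fun p hp =>
    ⟨fun _ => p, 0, monotone_const, fun _ => hp, fun _ => le_rfl, by simp⟩
  refine ⟨fun p => sSup (V p), fun p hp => ⟨le_csSup (hbdd p) (h0 p hp),
    csSup_le ⟨0, h0 p hp⟩ ?_⟩, fun p hp q hq hpq => ?_⟩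
  · rintro v ⟨P, m, hP, hS, -, rfl⟩
    exact h P hP hS m
  · suffices sSup (V p) ≤ sSup (V q) - |f q - f p| by linarith
    refine csSup_le ⟨0, h0 p hp⟩ ?_
    rintro v ⟨P, m, hP, hS, hle, rfl⟩
    -- A chain below p continued through p to q is a chain below q; its last link contributes |f q -
    -- f p|, and the link from P m to p is discarded.
    let Q : ℕ → ℝ × ℝ := fun i => if i ≤ m then P i else if i = m + 1 then p else q
    have hQ : Monotone Q := monotone_nat_of_le_succ fun i => by
      by_cases h1 : i + 1 ≤ m
      · have h2 : i ≤ m := by omega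
        simpa [Q, h1, h2] using hP (Nat.le_succ i)
      · by_cases h2 : i ≤ m
        · have : i = m := by omega
          subst this
          simpa [Q] using hle i
        · by_cases h3 : i = m + 1
          · subst h3
            simpa [Q] using hpq
          · have h4 : i ≠ m := by omega
            simp [Q, h1, h2, h3, h4]
    have hmem : ∑ i ∈ Finset.range (m + 2), |f (Q (i + 1)) - f (Q i)| ∈ V q := by
      refine ⟨Q, m + 2, hQ, fun i => ?_, fun i => ?_, rfl⟩
      · simp only [Q]; split_ifs
        exacts [hS i, hp, hq]
      · simp only [Q]; split_ifs
        exacts [(hle i).trans hpq, hpq, le_rfl]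
    have hle' := le_csSup (hbdd q) hmem
    rw [Finset.sum_range_succ, Finset.sum_range_succ] at hle'
    have hfirst : ∑ i ∈ Finset.range m, |f (Q (i + 1)) - f (Q i)|
        = ∑ i ∈ Finset.range m, |f (P (i + 1)) - f (P i)| := by
      refine Finset.sum_congr rfl fun i hi => ?_
      have h1 : i + 1 ≤ m := Finset.mem_range.1 hi
      have h2 : i ≤ m := by omega
      simp [Q, h1, h2]
    have hlast : |f (Q (m + 1 + 1)) - f (Q (m + 1))| = |f q - f p| := by simp [Q]
    rw [hfirst, hlast] at hle'
    have := abs_nonneg (f (Q (m + 1)) - f (Q m))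
    linarith

/-! ### The kernel measure and the power substitution -/

/-- The measure with density `(1 - θ) ^ (α - 1)` on `(0, 1)`. -/
noncomputable def unitKernelMeasure (α : ℝ) : Measure ℝ :=
  (volume.restrict (Ioo 0 1)).withDensity fun θ => ((1 - θ) ^ (α - 1)).toNNReal

/-- Positivity of α makes the singularity of the density at θ = 1 integrable. -/
lemma isFiniteMeasure_unitKernelMeasure {α : ℝ} (hα : 0 < α) :
    IsFiniteMeasure (unitKernelMeasure α) := by
  have h1 : IntervalIntegrable (fun θ : ℝ => θ ^ (α - 1)) volume 0 1 :=
    intervalIntegral.intervalIntegrable_rpow' (by linarith)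
  have h2 := (h1.comp_sub_left 1).symm
  simp only [sub_self, sub_zero] at h2
  rw [intervalIntegrable_iff_integrableOn_Ioo_of_le zero_le_one] at h2
  exact isFiniteMeasure_withDensity_ofReal h2.2

lemma integral_unitKernelMeasure (α : ℝ) (G : ℝ → ℝ) :
    ∫ θ, G θ ∂unitKernelMeasure α = ∫ θ in Ioo (0 : ℝ) 1, (1 - θ) ^ (α - 1) * G θ := by
  rw [unitKernelMeasure, integral_withDensity_eq_integral_smul (by fun_prop)]
  refine setIntegral_congr_fun measurableSet_Ioo fun θ hθ => ?_
  have : 0 ≤ (1 - θ) ^ (α - 1) := Real.rpow_nonneg (by linarith [hθ.2]) _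
  simp [NNReal.smul_def, Real.coe_toNNReal _ this]

lemma ae_unitKernelMeasure (α : ℝ) : ∀ᵐ θ ∂unitKernelMeasure α, θ ∈ Ioo (0 : ℝ) 1 :=
  (withDensity_absolutelyContinuous _ _).ae_le (ae_restrict_mem measurableSet_Ioo)

/-- The point of `[a, x]` whose `r`-th power is `(1 - θ) a ^ r + θ x ^ r`. -/
noncomputable def powInterp (r a x θ : ℝ) : ℝ := (a ^ r + θ * (x ^ r - a ^ r)) ^ r⁻¹

section powInterp

variable {r a x θ : ℝ}

lemma measurable_powInterp : Measurable (powInterp r a x) := by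
  unfold powInterp
  fun_prop

lemma powInterp_base_pos (ha : 0 < a) (hr : 0 < r) (hax : a ≤ x) (hθ : 0 ≤ θ) :
    0 < a ^ r + θ * (x ^ r - a ^ r) := by
  have h1 : a ^ r ≤ x ^ r := Real.rpow_le_rpow ha.le hax hr.le
  have h2 : 0 < a ^ r := Real.rpow_pos_of_pos ha r
  nlinarith

lemma powInterp_rpow (ha : 0 < a) (hr : 0 < r) (hax : a ≤ x) (hθ : 0 ≤ θ) :
    powInterp r a x θ ^ r = a ^ r + θ * (x ^ r - a ^ r) :=
  Real.rpow_inv_rpow (powInterp_base_pos ha hr hax hθ).le hr.ne'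

/-- Monotonicity in the endpoint at fixed θ is what makes the substitution send chains to chains. -/
lemma powInterp_mono_right {x' : ℝ} (ha : 0 < a) (hr : 0 < r) (hax : a ≤ x) (hxx : x ≤ x')
    (hθ : 0 ≤ θ) : powInterp r a x θ ≤ powInterp r a x' θ := by
  have h1 : x ^ r ≤ x' ^ r := Real.rpow_le_rpow (ha.le.trans hax) hxx hr.le
  refine Real.rpow_le_rpow (powInterp_base_pos ha hr hax hθ).le ?_ (inv_nonneg.2 hr.le)
  gcongr

lemma powInterp_mem_Icc (ha : 0 < a) (hr : 0 < r) (hax : a ≤ x) (hθ : θ ∈ Icc (0 : ℝ) 1) :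
    powInterp r a x θ ∈ Icc a x := by
  have hpos := powInterp_base_pos ha hr hax hθ.1
  have h1 : a ^ r ≤ x ^ r := Real.rpow_le_rpow ha.le hax hr.le
  have hx : 0 ≤ x := ha.le.trans hax
  constructor
  · rw [powInterp, Real.le_rpow_inv_iff_of_pos ha.le hpos.le hr]
    nlinarith [hθ.1]
  · rw [powInterp, Real.rpow_inv_le_iff_of_pos hpos.le hx hr]
    nlinarith [hθ.2]

end powInterp

/-- The substitution `s ^ (p + 1) = (1 - θ) a ^ (p + 1) + θ x ^ (p + 1)` in a one-dimensional
Katugampola integral. -/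
lemma integral_katugampola_kernel {a x p α : ℝ} (ha : 0 < a) (hax : a ≤ x) (hp : -1 < p)
    (hα : 0 < α) (G : ℝ → ℝ) :
    ∫ s in a..x, (x ^ (p + 1) - s ^ (p + 1)) ^ (α - 1) * s ^ p * G s =
      (x ^ (p + 1) - a ^ (p + 1)) ^ α / (p + 1) *
        ∫ θ, G (powInterp (p + 1) a x θ) ∂unitKernelMeasure α := by
  have hr : 0 < p + 1 := by linarith
  -- In the degenerate case x = a both sides vanish, since 0 ^ α = 0 for α ≠ 0.
  rcases hax.eq_or_lt with rfl | hlt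
  · simp [hα.ne']
  have hX : a ^ (p + 1) < x ^ (p + 1) := Real.rpow_lt_rpow ha.le hlt hr
  set D := x ^ (p + 1) - a ^ (p + 1) with hD
  have hD0 : 0 < D := sub_pos.2 hX
  let ρ : ℝ → ℝ := fun s => (s ^ (p + 1) - a ^ (p + 1)) / D
  have hinv : ∀ s ∈ Ioo a x, powInterp (p + 1) a x (ρ s) = s := fun s hs => by
    have : a ^ (p + 1) + ρ s * (x ^ (p + 1) - a ^ (p + 1)) = s ^ (p + 1) := by
      simp only [ρ, ← hD]
      field_simp
      ring
    rw [powInterp, this, Real.rpow_rpow_inv (ha.trans hs.1).le hr.ne']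
  have himage : ρ '' Ioo a x = Ioo 0 1 := by
    ext θ
    constructor
    · rintro ⟨s, hs, rfl⟩
      have h1 : a ^ (p + 1) < s ^ (p + 1) := Real.rpow_lt_rpow ha.le hs.1 hr
      have h2 : s ^ (p + 1) < x ^ (p + 1) := Real.rpow_lt_rpow (ha.trans hs.1).le hs.2 hr
      exact ⟨div_pos (by linarith) hD0, (div_lt_one hD0).2 (by linarith)⟩
    · intro hθ
      have hpw := powInterp_rpow ha hr hax hθ.1.le
      have hm := powInterp_mem_Icc ha hr hax ⟨hθ.1.le, hθ.2.le⟩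
      refine ⟨powInterp (p + 1) a x θ, ⟨lt_of_le_of_ne hm.1 fun h => ?_,
        lt_of_le_of_ne hm.2 fun h => ?_⟩, ?_⟩
      · rw [← h, ← hD] at hpw
        nlinarith [mul_pos hθ.1 hD0]
      · rw [h, ← hD] at hpw
        nlinarith [mul_pos (sub_pos.2 hθ.2) hD0]
      · simp only [ρ, hpw]
        rw [← hD]
        field_simp
        ring
  have hderiv : ∀ s ∈ Ioo a x, HasDerivWithinAt ρ ((p + 1) * s ^ p / D) (Ioo a x) s :=
    fun s hs => by
      have := Real.hasDerivAt_rpow_const (x := s) (p := p + 1) (Or.inl (ha.trans hs.1).ne')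
      rw [add_sub_cancel_right] at this
      exact ((this.sub_const _).div_const _).hasDerivWithinAt
  have hinj : InjOn ρ (Ioo a x) := fun s hs t ht h => by
    rw [← hinv s hs, ← hinv t ht, h]
  -- This change of variables asks nothing of the integrand, so G is arbitrary and can later be an
  -- inner integral of f.
  rw [integral_unitKernelMeasure, ← himage,
    integral_image_eq_integral_abs_deriv_smul measurableSet_Ioo hderiv hinj,
    ← integral_const_mul, intervalIntegral.integral_of_le hax, integral_Ioc_eq_integral_Ioo]
  refine setIntegral_congr_fun measurableSet_Ioo fun s hs => ?_
  have hs0 : 0 < s := ha.trans hs.1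
  have h2 : 0 ≤ x ^ (p + 1) - s ^ (p + 1) :=
    sub_nonneg.2 (Real.rpow_le_rpow hs0.le hs.2.le hr.le)
  have hone : 1 - ρ s = (x ^ (p + 1) - s ^ (p + 1)) / D := by
    simp only [ρ]
    field_simp
    rw [hD]
    ring
  have hsp : 0 ≤ (p + 1) * s ^ p / D := by positivity
  simp only [smul_eq_mul]
  rw [hinv s hs, hone, abs_of_nonneg hsp, Real.div_rpow h2 hD0.le, Real.rpow_sub_one hD0.ne']
  have : 0 < D ^ α := Real.rpow_pos_of_pos hD0 α
  field_simp

/-- The mixed Katugampola integral as a product of powers and of an average of `f`. -/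
lemma mixedKatugampola_eq {a c p q α β x y : ℝ} (ha : 0 < a) (hc : 0 < c) (hax : a ≤ x)
    (hcy : c ≤ y) (hp : -1 < p) (hq : -1 < q) (hα : 0 < α) (hβ : 0 < β) (f : ℝ × ℝ → ℝ) :
    mixedKatugampola p q a c α β f x y =
      (p + 1) ^ (1 - α) * (q + 1) ^ (1 - β) / (Real.Gamma α * Real.Gamma β) *
        ((x ^ (p + 1) - a ^ (p + 1)) ^ α / (p + 1) * ((y ^ (q + 1) - c ^ (q + 1)) ^ β / (q + 1) *
          ∫ θ, ∫ η, f (powInterp (p + 1) a x θ, powInterp (q + 1) c y η)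
            ∂unitKernelMeasure β ∂unitKernelMeasure α)) := by
  rw [mixedKatugampola]
  congr 1
  have hinner : ∀ s : ℝ, ∫ t in c..y,
      (x ^ (p + 1) - s ^ (p + 1)) ^ (α - 1) * (y ^ (q + 1) - t ^ (q + 1)) ^ (β - 1) *
        s ^ p * t ^ q * f (s, t) =
      (x ^ (p + 1) - s ^ (p + 1)) ^ (α - 1) * s ^ p * ((y ^ (q + 1) - c ^ (q + 1)) ^ β / (q + 1) *
        ∫ η, f (s, powInterp (q + 1) c y η) ∂unitKernelMeasure β) := fun s => by
    rw [← integral_katugampola_kernel hc hcy hq hβ fun t => f (s, t),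
      ← intervalIntegral.integral_const_mul]
    congr 1
    ext t
    ring
  simp_rw [hinner]
  rw [integral_katugampola_kernel ha hax hp hα fun s =>
    (y ^ (q + 1) - c ^ (q + 1)) ^ β / (q + 1) *
      ∫ η, f (s, powInterp (q + 1) c y η) ∂unitKernelMeasure β, integral_const_mul]

/-! ### Bounded variation of the fractional integral -/

/-- Averages of a function of bounded variation along chains over monotone deformations of the
identity are of bounded variation. -/
lemma ChainBV.integral {Ω : Type*} [MeasurableSpace Ω] {μ : Measure Ω} [IsFiniteMeasure μ]
    {S T : Set (ℝ × ℝ)} {f : ℝ × ℝ → ℝ} {M : ℝ} (hf : ChainBV T f M) {φ : ℝ × ℝ → Ω → ℝ × ℝ}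
    (hmaps : ∀ᵐ ω ∂μ, ∀ p ∈ S, φ p ω ∈ T)
    (hmono : ∀ᵐ ω ∂μ, ∀ p ∈ S, ∀ q ∈ S, p ≤ q → φ p ω ≤ φ q ω)
    (hint : ∀ p ∈ S, Integrable (fun ω => f (φ p ω)) μ) :
    ChainBV S (fun p => ∫ ω, f (φ p ω) ∂μ) (M * μ.real univ) := by
  intro P hP hS m
  have hint' : ∀ i, Integrable (fun ω => |f (φ (P (i + 1)) ω) - f (φ (P i) ω)|) μ := fun i =>
    ((hint _ (hS _)).sub (hint _ (hS _))).abs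
  calc ∑ i ∈ Finset.range m, |(∫ ω, f (φ (P (i + 1)) ω) ∂μ) - ∫ ω, f (φ (P i) ω) ∂μ|
      ≤ ∑ i ∈ Finset.range m, ∫ ω, |f (φ (P (i + 1)) ω) - f (φ (P i) ω)| ∂μ := by
        refine Finset.sum_le_sum fun i _ => ?_
        rw [← integral_sub (hint _ (hS _)) (hint _ (hS _))]
        exact abs_integral_le_integral_abs
    _ = ∫ ω, ∑ i ∈ Finset.range m, |f (φ (P (i + 1)) ω) - f (φ (P i) ω)| ∂μ :=
        (integral_finsetSum _ fun i _ => hint' i).symm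
    _ ≤ ∫ _, M ∂μ := by
        refine integral_mono_ae (integrable_finsetSum _ fun i _ => hint' i)
          (integrable_const _) ?_
        filter_upwards [hmaps, hmono] with ω h1 h2
        exact hf (fun i => φ (P i) ω) (fun i j hij => h2 _ (hS _) _ (hS _) (hP hij))
          (fun i => h1 _ (hS _)) m
    _ = M * μ.real univ := by simp [mul_comm]

/-- The mixed Katugampola integral of a continuous function of bounded variation along chains is
of bounded variation along chains. -/
lemma exists_chainBV_mixedKatugampola {a b c d p q α β : ℝ} (ha : 0 < a) (hab : a ≤ b)
    (hc : 0 < c) (hcd : c ≤ d) (hp : -1 < p) (hq : -1 < q) (hα : 0 < α) (hβ : 0 < β)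
    {f : ℝ × ℝ → ℝ} (hf : ContinuousOn f (Icc a b ×ˢ Icc c d)) {M : ℝ}
    (hbv : ChainBV (Icc (a, c) (b, d)) f M) :
    ∃ N, ChainBV (Icc (a, c) (b, d)) (fun z => mixedKatugampola p q a c α β f z.1 z.2) N := by
  have hr : 0 < p + 1 := by linarith
  have hr' : 0 < q + 1 := by linarith
  have := isFiniteMeasure_unitKernelMeasure hα
  have := isFiniteMeasure_unitKernelMeasure hβ
  set S : Set (ℝ × ℝ) := Icc (a, c) (b, d) with hS
  have hSprod : S = Icc a b ×ˢ Icc c d := (Icc_prod_Icc a b c d).symm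
  rw [← hSprod] at hf
  set μ := (unitKernelMeasure α).prod (unitKernelMeasure β) with hμ
  let φ : ℝ × ℝ → ℝ × ℝ → ℝ × ℝ := fun z ω =>
    (powInterp (p + 1) a z.1 ω.1, powInterp (q + 1) c z.2 ω.2)
  have hae : ∀ᵐ ω ∂μ, ω.1 ∈ Icc (0 : ℝ) 1 ∧ ω.2 ∈ Icc (0 : ℝ) 1 := by
    have h1 := (Measure.quasiMeasurePreserving_fst (μ := unitKernelMeasure α)
      (ν := unitKernelMeasure β)).ae (ae_unitKernelMeasure α)
    have h2 := (Measure.quasiMeasurePreserving_snd (μ := unitKernelMeasure α)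
      (ν := unitKernelMeasure β)).ae (ae_unitKernelMeasure β)
    filter_upwards [h1, h2] with ω h1 h2
    exact ⟨Ioo_subset_Icc_self h1, Ioo_subset_Icc_self h2⟩
  have hmaps : ∀ᵐ ω ∂μ, ∀ z ∈ S, φ z ω ∈ S := by
    filter_upwards [hae] with ω hω z hz
    have h1 := powInterp_mem_Icc ha hr hz.1.1 hω.1
    have h2 := powInterp_mem_Icc hc hr' hz.1.2 hω.2
    exact ⟨⟨h1.1, h2.1⟩, h1.2.trans hz.2.1, h2.2.trans hz.2.2⟩
  have hmono : ∀ᵐ ω ∂μ, ∀ z ∈ S, ∀ w ∈ S, z ≤ w → φ z ω ≤ φ w ω := by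
    filter_upwards [hae] with ω hω z hz w _ hzw
    exact ⟨powInterp_mono_right ha hr hz.1.1 hzw.1 hω.1.1,
      powInterp_mono_right hc hr' hz.1.2 hzw.2 hω.2.1⟩
  obtain ⟨B, hB⟩ : ∃ B, ∀ z ∈ S, ‖f z‖ ≤ B := isCompact_Icc.exists_bound_of_continuousOn hf
  have hφ : ∀ z, Measurable (φ z) := fun z =>
    (measurable_powInterp.comp measurable_fst).prodMk (measurable_powInterp.comp measurable_snd)
  -- Continuity of f is known only on the rectangle, so measurability of f ∘ φ is obtained from the
  -- extension of f by zero.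
  have hind : Measurable (S.indicator f) := by
    classical
    rw [← piecewise_eq_indicator]
    exact hf.measurable_piecewise continuousOn_const measurableSet_Icc
  have hint : ∀ z ∈ S, Integrable (fun ω => f (φ z ω)) μ := fun z hz => by
    refine Integrable.of_bound (C := B) ⟨fun ω => S.indicator f (φ z ω),
      (hind.comp (hφ z)).stronglyMeasurable, ?_⟩ ?_
    · filter_upwards [hmaps] with ω hω
      rw [indicator_of_mem (hω z hz)]
    · filter_upwards [hmaps] with ω hω
      exact hB _ (hω z hz)
  have hH := hbv.integral hmaps hmono hint
  have hHB : ∀ z ∈ S, |∫ ω, f (φ z ω) ∂μ| ≤ B * μ.real univ := fun z hz => by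
    rw [← Real.norm_eq_abs]
    refine norm_integral_le_of_norm_le_const ?_
    filter_upwards [hmaps] with ω hω
    exact hB _ (hω z hz)
  let K := (p + 1) ^ (1 - α) * (q + 1) ^ (1 - β) / (Real.Gamma α * Real.Gamma β)
  -- The factor in front of the average; it is nonnegative and nondecreasing, hence bounded by its
  -- value at (b, d).
  let w : ℝ × ℝ → ℝ := fun z => K * ((z.1 ^ (p + 1) - a ^ (p + 1)) ^ α / (p + 1) *
    ((z.2 ^ (q + 1) - c ^ (q + 1)) ^ β / (q + 1)))
  have hK : 0 ≤ K := by
    have := Real.Gamma_pos_of_pos hα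
    have := Real.Gamma_pos_of_pos hβ
    positivity
  have hsub : ∀ z ∈ S, 0 ≤ z.1 ^ (p + 1) - a ^ (p + 1) ∧ 0 ≤ z.2 ^ (q + 1) - c ^ (q + 1) :=
    fun z hz => ⟨sub_nonneg.2 (Real.rpow_le_rpow ha.le hz.1.1 hr.le),
      sub_nonneg.2 (Real.rpow_le_rpow hc.le hz.1.2 hr'.le)⟩
  have hw : MonotoneOn w S := fun z hz z' hz' hzz => by
    obtain ⟨h1, h2⟩ := hsub z hz
    obtain ⟨h1', h2'⟩ := hsub z' hz'
    have h3 := Real.rpow_le_rpow (ha.le.trans hz.1.1) hzz.1 hr.le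
    have h4 := Real.rpow_le_rpow (hc.le.trans hz.1.2) hzz.2 hr'.le
    simp only [w]
    gcongr
  have hw0 : ∀ z ∈ S, 0 ≤ w z := fun z hz => by
    obtain ⟨h1, h2⟩ := hsub z hz
    simp only [w]
    positivity
  have hwB : ∀ z ∈ S, |w z| ≤ w (b, d) := fun z hz => by
    rw [abs_of_nonneg (hw0 z hz)]
    exact hw hz ⟨⟨hab, hcd⟩, le_rfl⟩ hz.2
  refine ⟨_, fun P hP hPS m => le_trans (le_of_eq ?_)
    ((hw.chainBV hwB).mul hH hwB hHB P hP hPS m)⟩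
  have heq : ∀ z ∈ S, mixedKatugampola p q a c α β f z.1 z.2 =
      w z * ∫ ω, f (φ z ω) ∂μ := fun z hz => by
    rw [mixedKatugampola_eq ha hc hz.1.1 hz.1.2 hp hq hα hβ, hμ, integral_prod _ (hint z hz)]
    simp only [w, K, φ]
    ring
  refine Finset.sum_congr rfl fun i _ => ?_
  simp only [heq _ (hPS _)]

/-! ### Efficient covers of the graph -/

lemma exists_mem_Icc_grid {t : ℕ → ℝ} {n : ℕ} (hn : 0 < n) {x : ℝ} (h0 : t 0 ≤ x)
    (h1 : x ≤ t n) : ∃ i < n, x ∈ Icc (t i) (t (i + 1)) := by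
  induction n with
  | zero => omega
  | succ n ih =>
    by_cases hx : t n ≤ x
    · exact ⟨n, Nat.lt_succ_self n, hx, h1⟩
    · have hn' : 0 < n := Nat.pos_of_ne_zero fun h => hx (h ▸ h0)
      obtain ⟨i, hi, hm⟩ := ih hn' (le_of_not_ge hx)
      exact ⟨i, by omega, hm⟩

/-- Telescoping along the diagonals of a square array. -/
lemma sum_diagonal_sub_le {G : ℕ → ℕ → ℝ} {M : ℝ} (n : ℕ)
    (hG : ∀ i ≤ n, ∀ j ≤ n, 0 ≤ G i j ∧ G i j ≤ M) :
    ∑ i ∈ Finset.range n, ∑ j ∈ Finset.range n, (G (i + 1) (j + 1) - G i j) ≤ 2 * n * M := by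
  -- A diagonal step is split into a step in j at fixed i and a step in i at fixed j + 1; each kind
  -- telescopes.
  have h1 : ∑ i ∈ Finset.range n, ∑ j ∈ Finset.range n, (G (i + 1) (j + 1) - G i j) =
      ∑ j ∈ Finset.range n, (G n (j + 1) - G 0 (j + 1)) +
        ∑ i ∈ Finset.range n, (G i n - G i 0) := by
    rw [Finset.sum_congr rfl fun j _ => (Finset.sum_range_sub (fun i => G i (j + 1)) n).symm,
      Finset.sum_congr rfl fun i _ => (Finset.sum_range_sub (G i) n).symm,
      Finset.sum_comm (s := Finset.range n) (t := Finset.range n)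
      (f := fun j i => G (i + 1) (j + 1) - G i (j + 1)), ← Finset.sum_add_distrib]
    refine Finset.sum_congr rfl fun i _ => ?_
    rw [← Finset.sum_add_distrib]
    exact Finset.sum_congr rfl fun j _ => by ring
  have h2 : ∑ j ∈ Finset.range n, (G n (j + 1) - G 0 (j + 1)) ≤ ∑ _j ∈ Finset.range n, M :=
    Finset.sum_le_sum fun j hj => by
      have hj' : j + 1 ≤ n := Finset.mem_range.1 hj
      linarith [(hG n le_rfl _ hj').2, (hG 0 n.zero_le _ hj').1]
  have h3 : ∑ i ∈ Finset.range n, (G i n - G i 0) ≤ ∑ _i ∈ Finset.range n, M :=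
    Finset.sum_le_sum fun i hi => by
      have hi' : i ≤ n := (Finset.mem_range.1 hi).le
      linarith [(hG i hi' n le_rfl).2, (hG i hi' 0 n.zero_le).1]
  simp only [Finset.sum_const, Finset.card_range, nsmul_eq_mul] at h2 h3
  linarith

lemma dist_euclidean_three_le (x y z x' y' z' : ℝ) :
    dist !₂[x, y, z] !₂[x', y', z'] ≤ |x - x'| + |y - y'| + |z - z'| := by
  rw [EuclideanSpace.dist_eq, Fin.sum_univ_three]
  simp only [Real.dist_eq, Matrix.cons_val_zero, Matrix.cons_val_one, Matrix.cons_val]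
  refine Real.sqrt_le_iff.2 ⟨by positivity, ?_⟩
  nlinarith [abs_nonneg (x - x'), abs_nonneg (y - y'), abs_nonneg (z - z'),
    mul_nonneg (abs_nonneg (x - x')) (abs_nonneg (y - y')),
    mul_nonneg (abs_nonneg (x - x')) (abs_nonneg (z - z')),
    mul_nonneg (abs_nonneg (y - y')) (abs_nonneg (z - z'))]

/-- The box with one corner `(x, y, z)` and sides `u, v, w`. -/
def euclideanBox (x y z u v w : ℝ) : Set (EuclideanSpace ℝ (Fin 3)) :=
  {e | ∃ x' ∈ Icc x (x + u), ∃ y' ∈ Icc y (y + v), ∃ z' ∈ Icc z (z + w), e = !₂[x', y', z']}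

lemma ediam_euclideanBox_le (x y z u v w : ℝ) :
    Metric.ediam (euclideanBox x y z u v w) ≤ ENNReal.ofReal (u + v + w) := by
  refine Metric.ediam_le ?_
  rintro _ ⟨x₁, hx₁, y₁, hy₁, z₁, hz₁, rfl⟩ _ ⟨x₂, hx₂, y₂, hy₂, z₂, hz₂, rfl⟩
  rw [edist_dist]
  refine ENNReal.ofReal_le_ofReal ((dist_euclidean_three_le ..).trans ?_)
  have h : ∀ {l k s t : ℝ}, s ∈ Icc l (l + k) → t ∈ Icc l (l + k) → |s - t| ≤ k :=
    fun hs ht => abs_le.2 ⟨by linarith [hs.1, ht.2], by linarith [hs.2, ht.1]⟩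
  linarith [h hx₁ hx₂, h hy₁ hy₂, h hz₁ hz₂]

/-- The graph of a function with a monotone variation function is covered by `O(δ⁻²)` sets of
diameter at most `δ`. -/
lemma exists_cover_graphOnRect {a b c d M : ℝ} (hab : a < b) (hcd : c < d) {F : ℝ → ℝ → ℝ}
    {g : ℝ × ℝ → ℝ} (hg : ∀ p ∈ Icc (a, c) (b, d), 0 ≤ g p ∧ g p ≤ M)
    (hF : ∀ p ∈ Icc (a, c) (b, d), ∀ q ∈ Icc (a, c) (b, d), p ≤ q →
      |F q.1 q.2 - F p.1 p.2| ≤ g q - g p) :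
    ∃ C : ℝ, 0 < C ∧ ∀ δ : ℝ, 0 < δ → δ ≤ 1 →
      ∃ (N : ℕ) (U : Fin N → Set (EuclideanSpace ℝ (Fin 3))),
      (N : ℝ) ≤ C / δ ^ 2 ∧ (∀ i, Metric.ediam (U i) ≤ ENNReal.ofReal δ) ∧
        graphOnRect a b c d F ⊆ ⋃ i, U i := by
  have hM : 0 ≤ M := by
    have := hg (a, c) ⟨le_rfl, hab.le, hcd.le⟩
    linarith
  set L := (b - a) + (d - c) with hL
  have hL0 : 0 < L := by linarith
  -- With n ≤ (3L+1)/δ, this is δ² times the bound for n² + (6/δ)·2nM, the number of boxes. The 3 in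
  -- n makes cell sides at most δ/3, so a box of height δ/3 has diameter at most δ.
  refine ⟨(3 * L + 1) ^ 2 + 12 * (3 * L + 1) * M, by positivity, fun δ hδ hδ1 => ?_⟩
  set n := ⌈3 * L / δ⌉₊ with hn
  have hn0 : 0 < n := Nat.ceil_pos.2 (by positivity)
  have hn0' : (0 : ℝ) < n := Nat.cast_pos.2 hn0
  have hnle : (n : ℝ) ≤ (3 * L + 1) / δ := by
    have h1 := (Nat.ceil_lt_add_one (a := 3 * L / δ) (by positivity)).le
    have h2 : 1 ≤ 1 / δ := (one_le_div hδ).2 hδ1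
    rw [add_div]
    linarith
  have hnge : 3 * L / δ ≤ n := Nat.le_ceil _
  have hside : ∀ l ≤ L, l / n ≤ δ / 3 := fun l hl => by
    rw [div_le_iff₀ hn0']
    rw [div_le_iff₀ hδ] at hnge
    linarith
  let X : ℕ → ℝ := fun i => a + i * ((b - a) / n)
  let Y : ℕ → ℝ := fun j => c + j * ((d - c) / n)
  have hXs : ∀ i, X (i + 1) = X i + (b - a) / n := fun i => by simp [X]; ring
  have hYs : ∀ i, Y (i + 1) = Y i + (d - c) / n := fun i => by simp [Y]; ring
  have hXpos : 0 ≤ (b - a) / n := div_nonneg (by linarith) hn0'.le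
  have hYpos : 0 ≤ (d - c) / n := div_nonneg (by linarith) hn0'.le
  have hX0 : X 0 = a := by simp [X]
  have hY0 : Y 0 = c := by simp [Y]
  have hXn : X n = b := by simp only [X]; field_simp; ring
  have hYn : Y n = d := by simp only [Y]; field_simp; ring
  have hXm : Monotone X := monotone_nat_of_le_succ fun i => by rw [hXs]; linarith
  have hYm : Monotone Y := monotone_nat_of_le_succ fun i => by rw [hYs]; linarith
  have hmem : ∀ i ≤ n, ∀ j ≤ n, (X i, Y j) ∈ Icc (a, c) (b, d) := fun i hi j hj =>
    ⟨⟨hX0 ▸ hXm i.zero_le, hY0 ▸ hYm j.zero_le⟩, hXn ▸ hXm hi, hYn ▸ hYm hj⟩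
  let w : ℕ → ℕ → ℝ := fun i j => g (X (i + 1), Y (j + 1)) - g (X i, Y j)
  -- On a cell F stays within w of its value at the lower corner, an interval of length 2w; stacking
  -- boxes of height δ/3 gives the quotient 6w/δ.
  let K : ℕ → ℕ → ℕ := fun i j => ⌊6 * w i j / δ⌋₊ + 1
  have hw0 : ∀ i < n, ∀ j < n, 0 ≤ w i j := fun i hi j hj =>
    (abs_nonneg _).trans (hF _ (hmem i hi.le j hj.le) _ (hmem (i + 1) hi (j + 1) hj)
      ⟨hXm i.le_succ, hYm j.le_succ⟩)
  let ι := Σ ij : Fin n × Fin n, Fin (K ij.1 ij.2)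
  let B : ι → Set (EuclideanSpace ℝ (Fin 3)) := fun k =>
    euclideanBox (X k.1.1) (Y k.1.2)
      (F (X k.1.1) (Y k.1.2) - w k.1.1 k.1.2 + k.2 * (δ / 3)) ((b - a) / n) ((d - c) / n) (δ / 3)
  have hcard : (Fintype.card ι : ℝ) ≤ ((3 * L + 1) ^ 2 + 12 * (3 * L + 1) * M) / δ ^ 2 := by
    have h1 : (Fintype.card ι : ℝ) =
        ∑ i ∈ Finset.range n, ∑ j ∈ Finset.range n, (K i j : ℝ) := by
      simp only [ι, Fintype.card_sigma, Fintype.card_fin, Fintype.sum_prod_type]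
      push_cast
      simp_rw [Finset.sum_range]
    have h2 : ∑ i ∈ Finset.range n, ∑ j ∈ Finset.range n, (K i j : ℝ) ≤
        ∑ i ∈ Finset.range n, ∑ j ∈ Finset.range n, (6 / δ * w i j + 1) := by
      refine Finset.sum_le_sum fun i hi => Finset.sum_le_sum fun j hj => ?_
      have hw := hw0 i (Finset.mem_range.1 hi) j (Finset.mem_range.1 hj)
      have := Nat.floor_le (a := 6 * w i j / δ) (by positivity)
      simp only [K]
      push_cast
      rw [div_mul_eq_mul_div]
      linarith
    have h3 : ∑ i ∈ Finset.range n, ∑ j ∈ Finset.range n, (6 / δ * w i j + 1) =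
        6 / δ * (∑ i ∈ Finset.range n, ∑ j ∈ Finset.range n, w i j) + n * n := by
      simp [Finset.sum_add_distrib, Finset.mul_sum]
    have h4 : ∑ i ∈ Finset.range n, ∑ j ∈ Finset.range n, w i j ≤ 2 * n * M :=
      sum_diagonal_sub_le (G := fun i j => g (X i, Y j)) n
        fun i hi j hj => hg _ (hmem i hi j hj)
    calc (Fintype.card ι : ℝ) ≤ 6 / δ * (2 * n * M) + n * n := by
          rw [h1]
          refine h2.trans (h3.trans_le ?_)
          gcongr
      _ ≤ 6 / δ * (2 * ((3 * L + 1) / δ) * M) + (3 * L + 1) / δ * ((3 * L + 1) / δ) := by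
          gcongr
      _ = _ := by field_simp; ring
  refine ⟨Fintype.card ι, fun k => B ((Fintype.equivFin ι).symm k), hcard, fun k => ?_, ?_⟩
  · refine (ediam_euclideanBox_le ..).trans (ENNReal.ofReal_le_ofReal ?_)
    linarith [hside (b - a) (by linarith), hside (d - c) (by linarith)]
  · rintro _ ⟨x, hx, y, hy, rfl⟩
    obtain ⟨i, hi, hxi⟩ := exists_mem_Icc_grid hn0 (hX0.symm ▸ hx.1) (hXn.symm ▸ hx.2)
    obtain ⟨j, hj, hyj⟩ := exists_mem_Icc_grid hn0 (hY0.symm ▸ hy.1) (hYn.symm ▸ hy.2)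
    have hxy : (x, y) ∈ Icc (a, c) (b, d) := ⟨⟨hx.1, hy.1⟩, hx.2, hy.2⟩
    have h1 := hF _ (hmem i hi.le j hj.le) _ hxy ⟨hxi.1, hyj.1⟩
    -- The increment of g from (x, y) to the upper corner is nonnegative, so the increment up to (x,
    -- y) is at most w.
    have h2 := (abs_nonneg _).trans
      (hF _ hxy _ (hmem (i + 1) hi (j + 1) hj) ⟨hxi.2, hyj.2⟩)
    have h3 : |F x y - F (X i) (Y j)| ≤ w i j := by simp only [w]; linarith
    obtain ⟨h4, h5⟩ := abs_le.1 h3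
    set u := (F x y - (F (X i) (Y j) - w i j)) / (δ / 3) with hu
    have hu0 : 0 ≤ u := div_nonneg (by linarith) (by positivity)
    have huδ : u * (δ / 3) = F x y - (F (X i) (Y j) - w i j) := by
      rw [hu]; field_simp
    have hule : u ≤ 6 * w i j / δ := by
      rw [hu, div_le_div_iff₀ (by positivity) hδ]
      nlinarith
    have hk : ⌊u⌋₊ < K i j := Nat.lt_succ_of_le (Nat.floor_le_floor hule)
    refine mem_iUnion.2 ⟨Fintype.equivFin ι ⟨(⟨i, hi⟩, ⟨j, hj⟩), ⟨⌊u⌋₊, hk⟩⟩, ?_⟩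
    rw [Equiv.symm_apply_apply]
    refine ⟨x, hXs i ▸ hxi, y, hYs j ▸ hyj, F x y, ⟨?_, ?_⟩, rfl⟩
    · have := mul_le_mul_of_nonneg_right (Nat.floor_le hu0) (by positivity : 0 ≤ δ / 3)
      simp only
      linarith
    · have := mul_le_mul_of_nonneg_right (Nat.lt_floor_add_one u).le (by positivity : 0 ≤ δ / 3)
      simp only
      linarith

/-! ### Lower bound for covers by projection -/

/-- A planar set of diameter at most `δ` has area at most `(2δ)²`. -/
lemma volume_le_of_ediam_le {δ : ℝ} (hδ : 0 ≤ δ) {U : Set (ℝ × ℝ)}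
    (hU : Metric.ediam U ≤ ENNReal.ofReal δ) : volume U ≤ ENNReal.ofReal (4 * δ ^ 2) := by
  rcases U.eq_empty_or_nonempty with rfl | ⟨p, hp⟩
  · simp
  have hsub : U ⊆ Metric.closedBall p.1 δ ×ˢ Metric.closedBall p.2 δ := fun q hq => by
    rw [closedBall_prod_same, Metric.mem_closedBall, dist_edist]
    exact ENNReal.toReal_le_of_le_ofReal hδ ((Metric.edist_le_ediam_of_mem hq hp).trans hU)
  refine (measure_mono hsub).trans (le_of_eq ?_)
  rw [Measure.volume_eq_prod, Measure.prod_prod, Real.volume_closedBall, Real.volume_closedBall,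
    ← ENNReal.ofReal_mul (by positivity)]
  congr 1
  ring

/-- The projection of 3-space to the first two coordinates. -/
def planeProj (z : EuclideanSpace ℝ (Fin 3)) : ℝ × ℝ := (z 0, z 1)

lemma lipschitzWith_planeProj : LipschitzWith 1 planeProj := by
  refine LipschitzWith.of_dist_le_mul fun z w => ?_
  rw [NNReal.coe_one, one_mul, Prod.dist_eq]
  have h : ∀ i, dist (z i) (w i) ≤ dist z w := fun i => by
    rw [dist_eq_norm, dist_eq_norm]
    exact PiLp.norm_apply_le (z - w) i
  exact max_le (h 0) (h 1)

lemma planeProj_image_graphOnRect (a b c d : ℝ) (F : ℝ → ℝ → ℝ) :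
    planeProj '' graphOnRect a b c d F = Icc a b ×ˢ Icc c d := by
  ext ⟨x, y⟩
  constructor
  · rintro ⟨_, ⟨x', hx, y', hy, rfl⟩, h⟩
    simp only [planeProj, Prod.mk.injEq] at h
    obtain ⟨rfl, rfl⟩ := h
    exact ⟨hx, hy⟩
  · rintro ⟨hx, hy⟩
    exact ⟨_, ⟨x, hx, y, hy, rfl⟩, by simp [planeProj]⟩

/-- A cover of a graph over a rectangle by sets of diameter at most `δ` has at least
`area / (4 δ²)` members. -/
lemma area_le_of_cover_graphOnRect {a b c d δ : ℝ} (hδ : 0 ≤ δ) (hab : a ≤ b)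
    {F : ℝ → ℝ → ℝ} {N : ℕ} {U : Fin N → Set (EuclideanSpace ℝ (Fin 3))}
    (hU : ∀ i, Metric.ediam (U i) ≤ ENNReal.ofReal δ) (hcov : graphOnRect a b c d F ⊆ ⋃ i, U i) :
    (b - a) * (d - c) ≤ N * (4 * δ ^ 2) := by
  have h1 : Icc a b ×ˢ Icc c d ⊆ ⋃ i, planeProj '' U i := by
    rw [← planeProj_image_graphOnRect a b c d F, ← image_iUnion]
    exact image_mono hcov
  have h2 : volume (Icc a b ×ˢ Icc c d) ≤ ENNReal.ofReal (N * (4 * δ ^ 2)) :=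
    calc volume (Icc a b ×ˢ Icc c d) ≤ ∑ i, volume (planeProj '' U i) :=
          (measure_mono h1).trans (measure_iUnion_fintype_le _ _)
      _ ≤ ∑ _i : Fin N, ENNReal.ofReal (4 * δ ^ 2) := by
          refine Finset.sum_le_sum fun i _ => volume_le_of_ediam_le hδ ?_
          refine (lipschitzWith_planeProj.ediam_image_le _).trans ?_
          simpa using hU i
      _ = ENNReal.ofReal (N * (4 * δ ^ 2)) := by
          rw [Finset.sum_const, Finset.card_univ, Fintype.card_fin, nsmul_eq_mul,
            ENNReal.ofReal_mul N.cast_nonneg, ENNReal.ofReal_natCast]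
  rw [Measure.volume_eq_prod, Measure.prod_prod, Real.volume_Icc, Real.volume_Icc,
    ← ENNReal.ofReal_mul (by linarith)] at h2
  exact (ENNReal.ofReal_le_ofReal_iff (by positivity)).1 h2

/-! ### From covering numbers to dimensions -/

/-- A quantity of exact order `δ⁻²` grows with exponent `2`. -/
lemma tendsto_log_div_neg_log_of_bounds {N : ℝ → ℝ} {k C : ℝ} (hk : 0 < k)
    (hlow : ∀ δ, 0 < δ → δ ≤ 1 → k / δ ^ 2 ≤ N δ) (hup : ∀ δ, 0 < δ → δ ≤ 1 → N δ ≤ C / δ ^ 2) :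
    Tendsto (fun δ => Real.log (N δ) / (-Real.log δ)) (𝓝[>] 0) (𝓝 2) := by
  have hC : 0 < C := by
    have := (hlow 1 one_pos le_rfl).trans (hup 1 one_pos le_rfl)
    simp only [one_pow, div_one] at this
    linarith
  have hlim : Tendsto (fun δ : ℝ => -Real.log δ) (𝓝[>] 0) atTop :=
    tendsto_neg_atBot_atTop.comp Real.tendsto_log_nhdsGT_zero
  have hconst : ∀ e : ℝ, Tendsto (fun δ : ℝ => e / (-Real.log δ) + 2) (𝓝[>] 0) (𝓝 2) :=
    fun e => by simpa using (hlim.const_div_atTop e).add_const 2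
  have hev : ∀ᶠ δ : ℝ in 𝓝[>] 0, 0 < δ ∧ δ < 1 := Ioo_mem_nhdsGT one_pos
  have hlog : ∀ e δ : ℝ, 0 < e → 0 < δ → δ < 1 →
      Real.log (e / δ ^ 2) / (-Real.log δ) = Real.log e / (-Real.log δ) + 2 :=
    fun e δ he hδ hδ1 => by
      have := (Real.log_neg hδ hδ1).ne
      rw [Real.log_div he.ne' (by positivity), Real.log_pow]
      field_simp
      push_cast
      ring
  refine tendsto_of_tendsto_of_tendsto_of_le_of_le' (hconst (Real.log k)) (hconst (Real.log C))
    ?_ ?_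
  · filter_upwards [hev] with δ hδ
    have := (Real.log_neg hδ.1 hδ.2)
    have hδ0 := hδ.1
    rw [← hlog k δ hk hδ.1 hδ.2]
    exact div_le_div_of_nonneg_right (Real.log_le_log (by positivity) (hlow δ hδ.1 hδ.2.le))
      (by linarith)
  · filter_upwards [hev] with δ hδ
    have := (Real.log_neg hδ.1 hδ.2)
    have hδ0 := hδ.1
    rw [← hlog C δ hC hδ.1 hδ.2]
    have hpos : 0 < N δ := lt_of_lt_of_le (by positivity) (hlow δ hδ.1 hδ.2.le)
    exact div_le_div_of_nonneg_right (Real.log_le_log hpos (hup δ hδ.1 hδ.2.le)) (by linarith)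

section cover

variable {X : Type*} {A : Set X} {C : ℝ}

/-- At scales δ = 1/(n+1) the sums of squared diameters are at most C, so the 2-dimensional
Hausdorff measure is finite. -/
lemma dimH_le_two_of_covers [MetricSpace X]
    (h : ∀ δ : ℝ, 0 < δ → δ ≤ 1 → ∃ (N : ℕ) (U : Fin N → Set X), (N : ℝ) ≤ C / δ ^ 2 ∧
      (∀ i, Metric.ediam (U i) ≤ ENNReal.ofReal δ) ∧ A ⊆ ⋃ i, U i) : dimH A ≤ 2 := by
  borelize X
  let δ : ℕ → ℝ := fun n => 1 / (n + 1)
  have hδ0 : ∀ n, 0 < δ n := fun n => Nat.one_div_pos_of_nat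
  have hδ1 : ∀ n, δ n ≤ 1 := fun n => by
    have : (1 : ℝ) ≤ n + 1 := by linarith [n.cast_nonneg (α := ℝ)]
    exact div_le_one_of_le₀ this (by positivity)
  choose N U hN hU hcov using fun n => h (δ n) (hδ0 n) (hδ1 n)
  have hr : Tendsto (fun n => ENNReal.ofReal (δ n)) atTop (𝓝 0) := by
    have := ENNReal.tendsto_ofReal (tendsto_one_div_add_atTop_nhds_zero_nat (𝕜 := ℝ))
    rwa [ENNReal.ofReal_zero] at this
  have hle : μH[(2 : ℝ)] A ≤ ENNReal.ofReal C := by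
    refine (Measure.hausdorffMeasure_le_liminf_sum 2 A _ hr U (.of_forall hU)
      (.of_forall hcov)).trans ?_
    refine liminf_le_of_le (by isBoundedDefault) fun e he => ?_
    obtain ⟨n, hn⟩ := he.exists
    refine hn.trans ?_
    calc ∑ i, Metric.ediam (U n i) ^ (2 : ℝ)
        ≤ ∑ _i : Fin (N n), ENNReal.ofReal (δ n ^ 2) := by
          refine Finset.sum_le_sum fun i _ => ?_
          rw [ENNReal.ofReal_pow (hδ0 n).le, ENNReal.rpow_two]
          gcongr
          exact hU n i
      _ = ENNReal.ofReal (N n * δ n ^ 2) := by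
          rw [Finset.sum_const, Finset.card_univ, Fintype.card_fin, nsmul_eq_mul,
            ENNReal.ofReal_mul (by positivity), ENNReal.ofReal_natCast]
      _ ≤ ENNReal.ofReal C := by
          refine ENNReal.ofReal_le_ofReal ?_
          have := hN n
          rwa [le_div_iff₀ (pow_pos (hδ0 n) 2)] at this
  have := dimH_le_of_hausdorffMeasure_ne_top (s := A) (d := 2)
    (ne_top_of_le_ne_top ENNReal.ofReal_ne_top hle)
  simpa using this

/-- One finite cover makes the infimum an attained minimum rather than the default value `sInf ∅ =
0`. -/
lemma exists_cover_minCoverCard [PseudoMetricSpace X] {δ : ℝ} {N : ℕ} {U : Fin N → Set X}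
    (hU : ∀ i, Metric.ediam (U i) ≤ ENNReal.ofReal δ) (hcov : A ⊆ ⋃ i, U i) :
    minCoverCard δ A ≤ N ∧ ∃ V : Fin (minCoverCard δ A) → Set X,
      (∀ i, Metric.ediam (V i) ≤ ENNReal.ofReal δ) ∧ A ⊆ ⋃ i, V i :=
  ⟨Nat.sInf_le ⟨U, hU, hcov⟩, Nat.sInf_mem (s := {n : ℕ | ∃ U : Fin n → Set X,
    (∀ i, Metric.ediam (U i) ≤ ENNReal.ofReal δ) ∧ A ⊆ ⋃ i, U i}) ⟨N, U, hU, hcov⟩⟩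

end cover

/-- A Lipschitz projection does not raise Hausdorff dimension, and its image has nonempty interior
in the plane. -/
lemma two_le_dimH_graphOnRect {a b c d : ℝ} (hab : a < b) (hcd : c < d) (F : ℝ → ℝ → ℝ) :
    2 ≤ dimH (graphOnRect a b c d F) := by
  have h1 := lipschitzWith_planeProj.dimH_image_le (graphOnRect a b c d F)
  have h2 : (interior (Icc a b ×ˢ Icc c d)).Nonempty := by
    rw [interior_prod_eq, interior_Icc, interior_Icc]
    exact (nonempty_Ioo.2 hab).prod (nonempty_Ioo.2 hcd)
  rw [planeProj_image_graphOnRect, Real.dimH_of_nonempty_interior h2] at h1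
  simpa using h1

theorem mainTheorem1 (a b c d : ℝ) (ha : 0 < a) (hab : a < b) (hc : 0 < c) (hcd : c < d)
    (p q α β : ℝ) (hp : -1 < p) (hq : -1 < q) (hα : 0 < α) (hβ : 0 < β)
    (f : ℝ × ℝ → ℝ) (hf : ContinuousOn f (Icc a b ×ˢ Icc c d)) (hbv : ArzelaBV a b c d f) :
    HasBoxDim (graphOnRect a b c d (mixedKatugampola p q a c α β f)) 2 ∧
      dimH (graphOnRect a b c d (mixedKatugampola p q a c α β f)) = 2 := by
  obtain ⟨M, hM⟩ := hbv.exists_chainBV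
  obtain ⟨N, hN⟩ : ∃ N, ChainBV (Icc (a, c) (b, d))
      (fun z => mixedKatugampola p q a c α β f z.1 z.2) N :=
    exists_chainBV_mixedKatugampola ha hab.le hc hcd.le hp hq hα hβ hf hM
  obtain ⟨g, hg, hgF⟩ := hN.exists_majorant
  obtain ⟨C, hC, hcov⟩ := exists_cover_graphOnRect hab hcd hg hgF
  set A := graphOnRect a b c d (mixedKatugampola p q a c α β f) with hA
  refine ⟨⟨⟨_, a, left_mem_Icc.2 hab.le, c, left_mem_Icc.2 hcd.le, rfl⟩, ?_, ?_⟩,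
    le_antisymm (dimH_le_two_of_covers hcov) (two_le_dimH_graphOnRect hab hcd _)⟩
  · obtain ⟨n, U, -, hU, hAU⟩ := hcov 1 one_pos le_rfl
    refine (Bornology.isBounded_iUnion.2 fun i => ?_).subset hAU
    exact Metric.isBounded_iff_ediam_ne_top.2 (ne_top_of_le_ne_top ENNReal.ofReal_ne_top (hU i))
  · refine tendsto_log_div_neg_log_of_bounds (k := (b - a) * (d - c) / 4) (C := C)
      (by have := sub_pos.2 hab; have := sub_pos.2 hcd; positivity)
      (fun δ hδ hδ1 => ?_) (fun δ hδ hδ1 => ?_)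
    · obtain ⟨n, U, -, hU, hAU⟩ := hcov δ hδ hδ1
      obtain ⟨-, V, hV, hAV⟩ := exists_cover_minCoverCard hU hAU
      have := area_le_of_cover_graphOnRect hδ.le hab.le hV hAV
      rw [div_le_iff₀ (by positivity)]
      linarith
    · obtain ⟨n, U, hn, hU, hAU⟩ := hcov δ hδ hδ1
      exact (Nat.cast_le.2 (exists_cover_minCoverCard hU hAU).1).trans hn
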